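/- Let $X_1,X_2,\dots$ be i.i.d. real random variables (shocks) with distribution $F$, and write $\bar F(x)=P\{X_1\ge x\}$. For each $t\in\mathbb R$ let $\gamma(t)\le\beta(t)$, $\alpha(t)$ be real numbers and $0=b_0(t)\le b_1(t)\le\dots$, $0=c_0(t)\le c_1(t)\le\dots$ be nondecreasing sequences such that $\alpha_{k,l}(t):=\alpha(t)+b_k(t)-c_l(t)\ge\beta(t)$ for all $k,l\ge 0$. Omitting $t$ from the notation, define recursively, for $n\ge 0$ and with sums over indices $i\ge 1$, $$N_-(n)=\sum_{1\le i<n}1\{X_i\in[\beta,\ \alpha_{N_+(i),N_-(i)})\},\qquad N_+(n)=\sum_{1\le i<n}1\{X_i\in[\gamma,\beta),\ N_-(i)=0\},$$ and let $\nu=\min\{i\ge 1: X_i\ge\alpha_{N_+(i),N_-(i)}\}$ be the index of the first fatal shock ($\nu=\infty$ if there is none; the events below include $\nu<\infty$). Assume that, as $t\to\infty$, $\bar F(\beta(t))\to 0$, $$\frac{\bar F(\beta(t))}{\bar F(\gamma(t))}\to g\in[0,1],\qquad \frac{\bar F(\alpha_{k,l}(t))}{\bar F(\beta(t))}\to a_{k,l}\in(0,1]\quad\text{for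 all }k,l\ge 0 .$$ Let $z\ge 0$. If $g>0$, then the following hold. i) For every $k\ge 0$, $$\lim_{t\to\infty}P\{\nu\ge z/\bar F(\beta),\,N_+(\nu)=k,\,N_-(\nu)=0\}=\int_{z/g}^\infty v^k e^{-v}\,dv\;\frac{g(1-g)^k a_{k,0}}{k!}.$$ ii) For every $k\ge 0$ and $l\ge 1$, $$\lim_{t\to\infty}P\{\nu\ge z/\bar F(\beta),\,N_+(\nu)=k,\,N_-(\nu)=l\}=\int_z^\infty\!\int_0^1 y^k(1-y)^{l-1}e^{-yu(g^{-1}-1)}\,dy\;e^{-u}u^{k+l}\,du\;\cdot\Big(\frac{1-g}{g}\Big)^k\,\frac{\prod_{h=0}^{l-1}(1-a_{k,h})\,a_{k,l}}{k!\,(l-1)!}.$$ (Here $0^0=1$.) If $g=0$, then both limits are $0$ for all $k,l\ge 0$ (the limiting values of the right-hand sides as $g\downarrow 0$). -/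

import Mathlib

open MeasureTheory ProbabilityTheory Filter Topology

/-- The load levels of a shock model whose critical threshold first may increase and later
decreases: shocks in `[gamma, beta)` strengthen the material (as long as there was no weakening
shock), after `k` strengthening and `l` weakening shocks the critical level is
`alpha + b k - c l`, and this level never falls below `beta`. -/
structure LoadLevels where
  gamma : ℝ
  beta : ℝ
  alpha : ℝ
  b : ℕ → ℝ
  c : ℕ → ℝ
  gamma_le_beta : gamma ≤ beta
  b_zero : b 0 = 0
  c_zero : c 0 = 0
  b_mono : Monotone b
  c_mono : Monotone c
  beta_le : ∀ k l, beta ≤ alpha + b k - c l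

namespace LoadLevels

/-- The critical level `α_{k,l} = α + b_k - c_l`. -/
def level (S : LoadLevels) (k l : ℕ) : ℝ := S.alpha + S.b k - S.c l

open Classical in
/-- The pair `(N₊(n), N₋(n))` for the sequence of shocks `x 1, x 2, …` (the value `x 0` is not
used): numbers of strengthening and of weakening shocks `x i` with `1 ≤ i < n`. -/
noncomputable def counts (S : LoadLevels) (x : ℕ → ℝ) : ℕ → ℕ × ℕ
  | 0 => (0, 0)
  | 1 => (0, 0)
  | n + 2 =>
    let s := counts S x (n + 1)
    (s.1 + (if x (n + 1) ∈ Set.Ico S.gamma S.beta ∧ s.2 = 0 then 1 else 0),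
      s.2 + (if x (n + 1) ∈ Set.Ico S.beta (S.level s.1 s.2) then 1 else 0))

/-- `N₊(n)`, the number of strengthening shocks before the `n`-th shock. -/
noncomputable def nPlus (S : LoadLevels) (x : ℕ → ℝ) (n : ℕ) : ℕ := (S.counts x n).1

/-- `N₋(n)`, the number of weakening shocks before the `n`-th shock. -/
noncomputable def nMinus (S : LoadLevels) (x : ℕ → ℝ) (n : ℕ) : ℕ := (S.counts x n).2

open Classical in
theorem nPlus_eq_sum (S : LoadLevels) (x : ℕ → ℝ) (n : ℕ) :
    S.nPlus x n = ∑ i ∈ Finset.Ico 1 n,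
      if x i ∈ Set.Ico S.gamma S.beta ∧ S.nMinus x i = 0 then 1 else 0 := by
  induction n with
  | zero => simp [nPlus, counts]
  | succ n ih =>
    cases n with
    | zero => simp [nPlus, counts]
    | succ n =>
      rw [Finset.sum_Ico_succ_top (by omega), ← ih]
      simp only [nPlus, nMinus, counts]
      congr

open Classical in
theorem nMinus_eq_sum (S : LoadLevels) (x : ℕ → ℝ) (n : ℕ) :
    S.nMinus x n = ∑ i ∈ Finset.Ico 1 n,
      if x i ∈ Set.Ico S.beta (S.level (S.nPlus x i) (S.nMinus x i)) then 1 else 0 := by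
  induction n with
  | zero => simp [nMinus, counts]
  | succ n ih =>
    cases n with
    | zero => simp [nMinus, counts]
    | succ n =>
      rw [Finset.sum_Ico_succ_top (by omega), ← ih]
      simp only [nPlus, nMinus, counts]
      congr

/-- The index `ν = min {i ≥ 1 : x i ≥ α + b_{N₊(i)} - c_{N₋(i)}}` of the first fatal shock,
with `ν = ∞` if no shock is fatal. -/
noncomputable def nu (S : LoadLevels) (x : ℕ → ℝ) : ℕ∞ :=
  ⨅ (i : ℕ) (_ : 1 ≤ i ∧ S.level (S.nPlus x i) (S.nMinus x i) ≤ x i), (i : ℕ∞)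

/-- The event `{ν ≥ r, N₊(ν) = k, N₋(ν) = l}` (which includes `ν < ∞`). -/
def failureEvent {Ω : Type*} (S : LoadLevels) (X : ℕ → Ω → ℝ) (r : ℝ) (k l : ℕ) : Set Ω :=
  {ω | ∃ m : ℕ, S.nu (fun i => X i ω) = m ∧ r ≤ (m : ℝ) ∧
    S.nPlus (fun i => X i ω) m = k ∧ S.nMinus (fun i => X i ω) m = l}

end LoadLevels

/-- The tail `F̄(x) = F [x, ∞)` of a probability distribution `F` on the real line. -/
noncomputable def tail (F : Measure ℝ) (x : ℝ) : ℝ := F.real (Set.Ici x)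

/-! Write `p` and `q` for the tails of `F` at `gamma` and `beta`. The counts of strengthening and
weakening shocks, killed at the first fatal shock, form a Markov chain. Before any weakening the
chain stays at its state with probability `1 - p` and moves from `k` to `k + 1` with probability `p
- q`. After a weakening shock `k` is frozen: the chain stays with probability `1 - q`, and the
`h`-th level is left for the next one with probability `q` minus the tail at `level k h`. The
resulting recursions for the survival probabilities are solved explicitly. Without weakening the
solution is `(p - q)^k C(n,k) (1 - p)^(n - k)`. With weakening it is a product of one-step
probabilities times a convolution of two binomial weights, split at the first weakening shock
(`measureReal_survival_eq_binomWeight`, `measureReal_survival_eq_binomConv`).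

The failure probability is the sum over `n + 1 ≥ z / q` of survival probability times tail at the
critical level. That tail is `q` times a convergent ratio, so the sum is a Riemann sum of mesh `q`
in the variable `u = n q`. Since `p / q → 1 / g`, the rescaled weights have Poisson-type limits, and
they are dominated by a multiple of `u^m e^(-u)`. Dominated convergence
(`tendsto_integral_natFloor`) gives the limiting integral; inside the convolution a second Riemann
sum produces the integral over `y`, the relative position of the first weakening shock.

If `g = 0` no asymptotics are needed: the expected time spent in any state is at most `1 / p`, so
the failure probability is at most `q / p → 0`. -/

namespace LoadLevels

/-! ### Survival events and their one-step decomposition -/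

/-- The event that none of the first `n` shocks is fatal and that `k` of them were strengthening
and `l` of them were weakening. -/
def survival {Ω : Type*} (S : LoadLevels) (X : ℕ → Ω → ℝ) (n k l : ℕ) : Set Ω :=
  {ω | (∀ i, 1 ≤ i → i ≤ n → X i ω <
      S.level (S.nPlus (fun j => X j ω) i) (S.nMinus (fun j => X j ω) i)) ∧
    S.counts (fun j => X j ω) (n + 1) = (k, l)}

variable {Ω : Type*} (S : LoadLevels) (X : ℕ → Ω → ℝ)

theorem beta_le_level (k l : ℕ) : S.beta ≤ S.level k l := S.beta_le k l

theorem survival_zero (k l : ℕ) :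
    S.survival X 0 k l = if k = 0 ∧ l = 0 then Set.univ else ∅ := by
  ext ω
  have h : (∀ i, 1 ≤ i → i ≤ 0 → X i ω <
      S.level (S.nPlus (fun j => X j ω) i) (S.nMinus (fun j => X j ω) i)) := by
    intro i h1 h2; omega
  split_ifs with hkl
  · refine iff_of_true ⟨h, ?_⟩ trivial
    simp [counts, hkl]
  · simp only [survival, counts, Set.mem_ofPred_eq, Prod.mk.injEq, Set.mem_empty_iff_false,
      iff_false]
    rintro ⟨-, h1, h2⟩
    exact hkl ⟨h1.symm, h2.symm⟩

-- This is the Markov property in pathwise form: the counts after shock `n + 1` depend only on the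
-- previous counts and on that shock.
open Classical in
theorem mem_survival_succ (n k l : ℕ) (ω : Ω) :
    ω ∈ S.survival X (n + 1) k l ↔ ∃ k' l', ω ∈ S.survival X n k' l' ∧
      X (n + 1) ω < S.level k' l' ∧
      k = k' + (if X (n + 1) ω ∈ Set.Ico S.gamma S.beta ∧ l' = 0 then 1 else 0) ∧
      l = l' + (if X (n + 1) ω ∈ Set.Ico S.beta (S.level k' l') then 1 else 0) := by
  simp only [survival, Set.mem_ofPred_eq]
  constructor
  · rintro ⟨h1, h2⟩
    refine ⟨S.nPlus (fun j => X j ω) (n + 1), S.nMinus (fun j => X j ω) (n + 1),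
      ⟨fun i hi hin => h1 i hi (by omega), rfl⟩, h1 (n + 1) (by omega) le_rfl, ?_⟩
    simp only [counts, Prod.mk.injEq] at h2
    exact ⟨h2.1.symm, h2.2.symm⟩
  · rintro ⟨k', l', ⟨h1, h2⟩, h3, h4, h5⟩
    have hp : S.nPlus (fun j => X j ω) (n + 1) = k' := by simp [nPlus, h2]
    have hm : S.nMinus (fun j => X j ω) (n + 1) = l' := by simp [nMinus, h2]
    refine ⟨fun i hi hin => ?_, ?_⟩
    · rcases Nat.lt_or_ge n i with h | h
      · obtain rfl : i = n + 1 := by omega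
        rwa [hp, hm]
      · exact h1 i hi h
    · simp only [counts, Prod.mk.injEq, h2]
      exact ⟨h4.symm, h5.symm⟩

/-- A nonfatal shock in `[gamma, beta)` would raise the first count and one above `beta` the second.
Conversely a shock below `gamma` is harmless because `gamma ≤ beta ≤ level`. -/
theorem survival_succ_zero_zero (n : ℕ) :
    S.survival X (n + 1) 0 0 = S.survival X n 0 0 ∩ X (n + 1) ⁻¹' Set.Iio S.gamma := by
  ext ω
  rw [mem_survival_succ]
  constructor
  · rintro ⟨k', l', h1, h2, h3, h4⟩
    obtain rfl : k' = 0 := by omega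
    obtain ⟨rfl, h4⟩ : l' = 0 ∧ _ := by simpa using h4.symm
    refine ⟨h1, ?_⟩
    simp only [Set.mem_preimage, Set.mem_Iio]
    by_contra! h
    rcases lt_or_ge (X (n + 1) ω) S.beta with hb | hb
    · rw [if_pos ⟨⟨h, hb⟩, rfl⟩] at h3
      omega
    · exact absurd h2 (not_lt.2 (h4 hb))
  · rintro ⟨h1, h2⟩
    have h2 : X (n + 1) ω < S.gamma := h2
    have := S.gamma_le_beta
    have := S.beta_le_level 0 0
    refine ⟨0, 0, h1, by linarith, ?_, ?_⟩
    · simp [h2.not_ge]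
    · simp [(h2.trans_le S.gamma_le_beta).not_ge]

theorem survival_succ_succ_zero (n k : ℕ) :
    S.survival X (n + 1) (k + 1) 0 =
      (S.survival X n (k + 1) 0 ∩ X (n + 1) ⁻¹' Set.Iio S.gamma) ∪
      (S.survival X n k 0 ∩ X (n + 1) ⁻¹' Set.Ico S.gamma S.beta) := by
  ext ω
  rw [mem_survival_succ]
  constructor
  · rintro ⟨k', l', h1, h2, h3, h4⟩
    obtain ⟨rfl, h4⟩ : l' = 0 ∧ _ := by simpa using h4.symm
    have hb : X (n + 1) ω < S.beta := by
      by_contra! h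
      exact absurd h2 (not_lt.2 (h4 h))
    by_cases hg : S.gamma ≤ X (n + 1) ω
    · right
      rw [if_pos ⟨⟨hg, hb⟩, rfl⟩] at h3
      obtain rfl : k = k' := by omega
      exact ⟨h1, hg, hb⟩
    · left
      rw [if_neg (fun h => hg h.1.1)] at h3
      obtain rfl : k' = k + 1 := by omega
      exact ⟨h1, not_le.1 hg⟩
  · have hgb := S.gamma_le_beta
    rintro (⟨h1, h2⟩ | ⟨h1, h2⟩)
    · have h2 : X (n + 1) ω < S.gamma := h2
      have := S.beta_le_level (k + 1) 0
      refine ⟨k + 1, 0, h1, by linarith, ?_, ?_⟩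
      · simp [h2.not_ge]
      · simp [(h2.trans_le hgb).not_ge]
    · have h2 : S.gamma ≤ X (n + 1) ω ∧ X (n + 1) ω < S.beta := h2
      have := S.beta_le_level k 0
      refine ⟨k, 0, h1, by linarith, ?_, ?_⟩
      · simp [h2]
      · simp [h2.2.not_ge]

/-- Once a weakening shock has occurred, shocks in `[gamma, beta)` no longer count. The threshold
for a neutral shock is therefore `beta` instead of `gamma`, and `k` cannot change; the weakening
step itself also leaves `k` alone. -/
theorem survival_succ_succ (n k l : ℕ) :
    S.survival X (n + 1) k (l + 1) =
      (S.survival X n k (l + 1) ∩ X (n + 1) ⁻¹' Set.Iio S.beta) ∪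
      (S.survival X n k l ∩ X (n + 1) ⁻¹' Set.Ico S.beta (S.level k l)) := by
  ext ω
  rw [mem_survival_succ]
  constructor
  · rintro ⟨k', l', h1, h2, h3, h4⟩
    by_cases hb : S.beta ≤ X (n + 1) ω
    · right
      rw [if_pos ⟨hb, h2⟩] at h4
      rw [if_neg (fun h => absurd h.1.2 (not_lt.2 hb))] at h3
      obtain rfl : k = k' := by omega
      obtain rfl : l = l' := by omega
      exact ⟨h1, hb, h2⟩
    · left
      rw [if_neg (fun h => hb h.1)] at h4
      obtain rfl : l' = l + 1 := by omega
      rw [if_neg (fun h => absurd h.2 (by omega))] at h3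
      obtain rfl : k = k' := by omega
      exact ⟨h1, not_le.1 hb⟩
  · rintro (⟨h1, h2⟩ | ⟨h1, h2⟩)
    · have h2 : X (n + 1) ω < S.beta := h2
      have := S.beta_le_level k (l + 1)
      refine ⟨k, l + 1, h1, by linarith, ?_, ?_⟩
      · simp
      · simp [h2.not_ge]
    · have h2 : S.beta ≤ X (n + 1) ω ∧ X (n + 1) ω < S.level k l := h2
      refine ⟨k, l, h1, h2.2, ?_, ?_⟩
      · simp [h2.1.not_gt]
      · simp [h2]

/-! ### The first fatal shock and the failure event as a disjoint union -/

theorem nu_eq_succ_iff (x : ℕ → ℝ) (n : ℕ) :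
    S.nu x = ((n + 1 : ℕ) : ℕ∞) ↔
      (∀ i, 1 ≤ i → i ≤ n → x i < S.level (S.nPlus x i) (S.nMinus x i)) ∧
        S.level (S.nPlus x (n + 1)) (S.nMinus x (n + 1)) ≤ x (n + 1) := by
  constructor
  · intro h
    have h1 : ∀ i, 1 ≤ i → i ≤ n → x i < S.level (S.nPlus x i) (S.nMinus x i) := by
      intro i hi hin
      by_contra! hc
      have : S.nu x ≤ i := iInf₂_le i ⟨hi, hc⟩
      rw [h, Nat.cast_le] at this
      omega
    refine ⟨h1, ?_⟩
    by_contra! hc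
    have : ((n + 2 : ℕ) : ℕ∞) ≤ S.nu x := by
      refine le_iInf₂ fun i hi => ?_
      rw [Nat.cast_le]
      by_contra! hlt
      rcases Nat.lt_or_ge n i with h2 | h2
      · obtain rfl : i = n + 1 := by omega
        exact absurd hi.2 (not_le.2 hc)
      · exact absurd hi.2 (not_le.2 (h1 i hi.1 h2))
    rw [h, Nat.cast_le] at this
    omega
  · rintro ⟨h1, h2⟩
    apply le_antisymm
    · exact iInf₂_le (n + 1) ⟨by omega, h2⟩
    · refine le_iInf₂ fun i hi => ?_
      rw [Nat.cast_le]
      by_contra! hlt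
      exact absurd hi.2 (not_le.2 (h1 i hi.1 (by omega)))

theorem nu_ne_zero (x : ℕ → ℝ) : S.nu x ≠ ((0 : ℕ) : ℕ∞) := by
  intro h
  have : ((1 : ℕ) : ℕ∞) ≤ S.nu x := le_iInf₂ fun i hi => by
    rw [Nat.cast_le]; exact hi.1
  rw [h, Nat.cast_le] at this
  omega

/-- The event of failure at shock `n + 1` with load counts `k` and `l`, restricted to
`n + 1 ≥ r`. -/
def failureAt (r : ℝ) (k l n : ℕ) : Set Ω :=
  {ω | r ≤ (n : ℝ) + 1 ∧ ω ∈ S.survival X n k l ∩ X (n + 1) ⁻¹' Set.Ici (S.level k l)}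

theorem failureEvent_eq_iUnion (r : ℝ) (k l : ℕ) :
    S.failureEvent X r k l = ⋃ n, S.failureAt X r k l n := by
  ext ω
  simp only [failureEvent, failureAt, Set.mem_ofPred_eq, Set.mem_iUnion]
  constructor
  · rintro ⟨m, h1, h2, h3, h4⟩
    cases m with
    | zero => exact absurd h1 (S.nu_ne_zero _)
    | succ n =>
      rw [nu_eq_succ_iff, h3, h4] at h1
      exact ⟨n, by simpa using h2, ⟨h1.1, Prod.ext h3 h4⟩, h1.2⟩
  · rintro ⟨n, h1, ⟨h2, h3⟩, h4⟩
    have hp : S.nPlus (fun j => X j ω) (n + 1) = k := by simp [nPlus, h3]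
    have hm : S.nMinus (fun j => X j ω) (n + 1) = l := by simp [nMinus, h3]
    refine ⟨n + 1, ?_, by simpa using h1, hp, hm⟩
    rw [nu_eq_succ_iff, hp, hm]
    exact ⟨h2, h4⟩

theorem failureAt_disjoint (r : ℝ) (k l : ℕ) :
    Pairwise (Function.onFun Disjoint (S.failureAt X r k l)) := by
  have key : ∀ m ω, ω ∈ S.failureAt X r k l m →
      S.nu (fun j => X j ω) = ((m + 1 : ℕ) : ℕ∞) := by
    rintro n ω ⟨h1, ⟨h2, h3⟩, h4⟩
    have hp : S.nPlus (fun j => X j ω) (n + 1) = k := by simp [nPlus, h3]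
    have hm : S.nMinus (fun j => X j ω) (n + 1) = l := by simp [nMinus, h3]
    rw [nu_eq_succ_iff, hp, hm]
    exact ⟨h2, h4⟩
  intro m n hmn
  refine Set.disjoint_left.2 fun ω h1 h2 => hmn ?_
  have := (key m ω h1).symm.trans (key n ω h2)
  rw [Nat.cast_inj] at this
  omega

/-- Survival through shock `n` is decided by the first `n` shocks; this is the form in which
independence from shock `n + 1` is applied. The shift `i + 1` leaves out `X 0`, about which nothing
is assumed. -/
theorem measurableSet_iSup_comap_survival (n k l : ℕ) :
    MeasurableSet[⨆ i ∈ Set.Iio n, MeasurableSpace.comap (X (i + 1)) inferInstance]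
      (S.survival X n k l) := by
  induction n generalizing k l with
  | zero =>
    rw [survival_zero]
    split_ifs
    · exact @MeasurableSet.univ _ (_)
    · exact @MeasurableSet.empty _ (_)
  | succ n ih =>
    have h1 : ∀ k l, MeasurableSet[⨆ i ∈ Set.Iio (n + 1),
        MeasurableSpace.comap (X (i + 1)) inferInstance] (S.survival X n k l) := fun k l =>
      (show (⨆ i ∈ Set.Iio n, MeasurableSpace.comap (X (i + 1)) inferInstance) ≤
          ⨆ i ∈ Set.Iio (n + 1), MeasurableSpace.comap (X (i + 1)) inferInstance from
        biSup_mono fun i (hi : i < n) => Nat.lt_succ_of_lt hi) _ (ih k l)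
    have h2 : ∀ B : Set ℝ, MeasurableSet B → MeasurableSet[⨆ i ∈ Set.Iio (n + 1),
        MeasurableSpace.comap (X (i + 1)) inferInstance] (X (n + 1) ⁻¹' B) := fun B hB =>
      (le_biSup (fun i => MeasurableSpace.comap (X (i + 1)) inferInstance)
        (show n ∈ Set.Iio (n + 1) from Nat.lt_succ_self n)) _ ⟨B, hB, rfl⟩
    cases l with
    | zero =>
      cases k with
      | zero =>
        rw [survival_succ_zero_zero]
        exact (h1 _ _).inter (h2 _ measurableSet_Iio)
      | succ k =>
        rw [survival_succ_succ_zero]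
        exact ((h1 _ _).inter (h2 _ measurableSet_Iio)).union
          ((h1 _ _).inter (h2 _ measurableSet_Ico))
    | succ l =>
      rw [survival_succ_succ]
      exact ((h1 _ _).inter (h2 _ measurableSet_Iio)).union
          ((h1 _ _).inter (h2 _ measurableSet_Ico))

end LoadLevels

/-! ### Tails, independence and recursions for the survival probabilities -/

theorem tail_nonneg (F : Measure ℝ) (x : ℝ) : 0 ≤ tail F x := measureReal_nonneg

theorem tail_le_one (F : Measure ℝ) [IsProbabilityMeasure F] (x : ℝ) : tail F x ≤ 1 :=
  measureReal_le_one

theorem tail_anti (F : Measure ℝ) [IsProbabilityMeasure F] : Antitone (tail F) :=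
  fun _ _ h => measureReal_mono (Set.Ici_subset_Ici.2 h)

theorem measureReal_Iio_eq_tail (F : Measure ℝ) [IsProbabilityMeasure F] (x : ℝ) :
    F.real (Set.Iio x) = 1 - tail F x := by
  rw [tail, ← Set.compl_Iio, probReal_compl_eq_one_sub measurableSet_Iio]; ring

theorem measureReal_Ico_eq_tail (F : Measure ℝ) [IsProbabilityMeasure F] {x y : ℝ} (h : x ≤ y) :
    F.real (Set.Ico x y) = tail F x - tail F y := by
  rw [tail, tail, ← measureReal_sdiff (Set.Ici_subset_Ici.2 h) measurableSet_Ici, Set.Ici_sdiff_Ici]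

/-- The sequence `X 1, X 2, …` is i.i.d. with distribution `F`. -/
structure IsShockSequence {Ω : Type*} [MeasurableSpace Ω] (P : Measure Ω) (F : Measure ℝ)
    (X : ℕ → Ω → ℝ) : Prop where
  meas : ∀ i, 1 ≤ i → Measurable (X i)
  law : ∀ i, 1 ≤ i → Measure.map (X i) P = F
  indep : iIndepFun (fun i : ℕ => X (i + 1)) P

namespace IsShockSequence

variable {Ω : Type*} [MeasurableSpace Ω] {P : Measure Ω} {F : Measure ℝ} {X : ℕ → Ω → ℝ}

theorem measurableSet_survival (hX : IsShockSequence P F X) (S : LoadLevels) (n k l : ℕ) :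
    MeasurableSet (S.survival X n k l) :=
  (iSup₂_le fun i _ => (hX.meas (i + 1) (by omega)).comap_le) _
    (S.measurableSet_iSup_comap_survival X n k l)

theorem measureReal_survival_inter (hX : IsShockSequence P F X) (S : LoadLevels) (n k l : ℕ)
    {B : Set ℝ} (hB : MeasurableSet B) :
    P.real (S.survival X n k l ∩ X (n + 1) ⁻¹' B) = P.real (S.survival X n k l) * F.real B := by
  have h := indep_iSup_of_disjoint (S := Set.Iio n) (T := {n})
    (fun i => (hX.meas (i + 1) (by omega)).comap_le) hX.indep.iIndep (by simp)
  rw [Indep_iff] at h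
  have := h _ _ (S.measurableSet_iSup_comap_survival X n k l)
    ((le_biSup (fun i => MeasurableSpace.comap (X (i + 1)) inferInstance)
      (Set.mem_singleton n)) (X (n + 1) ⁻¹' B) ⟨B, hB, rfl⟩)
  rw [measureReal_def, this, ENNReal.toReal_mul, measureReal_def, measureReal_def,
    ← hX.law (n + 1) (by omega), Measure.map_apply (hX.meas _ (by omega)) hB]

theorem measurableSet_failureAt (hX : IsShockSequence P F X) (S : LoadLevels) (r : ℝ)
    (k l n : ℕ) : MeasurableSet (S.failureAt X r k l n) := by
  by_cases h : r ≤ (n : ℝ) + 1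
  · simp only [LoadLevels.failureAt, h, true_and]
    exact (hX.measurableSet_survival S n k l).inter (hX.meas _ (by omega) measurableSet_Ici)
  · simp [LoadLevels.failureAt, h]

open Classical in
/-- The probability of failure at shock `n + 1` with load counts `k` and `l`. -/
theorem measureReal_failureAt (hX : IsShockSequence P F X) (S : LoadLevels) (r : ℝ)
    (k l n : ℕ) : P.real (S.failureAt X r k l n) =
      if r ≤ (n : ℝ) + 1 then P.real (S.survival X n k l) * tail F (S.level k l) else 0 := by
  rw [LoadLevels.failureAt]
  split_ifs with h
  · rw [tail, ← hX.measureReal_survival_inter S n k l measurableSet_Ici]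
    simp only [h, true_and]
    rfl
  · simp [h]

theorem measureReal_survival_zero [IsProbabilityMeasure P] (S : LoadLevels) (k l : ℕ) :
    P.real (S.survival X 0 k l) = if k = 0 ∧ l = 0 then 1 else 0 := by
  rw [LoadLevels.survival_zero]
  split_ifs <;> simp

open Classical in
/-- The probability of failure as a series over the number of shocks before the fatal one. -/
theorem measure_failureEvent [IsProbabilityMeasure P] (hX : IsShockSequence P F X) (S : LoadLevels) (r : ℝ) (k l : ℕ) :
    P (S.failureEvent X r k l) = ∑' n : ℕ, ENNReal.ofReal
      (if r ≤ (n : ℝ) + 1 then P.real (S.survival X n k l) * tail F (S.level k l) else 0) := by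
  rw [LoadLevels.failureEvent_eq_iUnion, measure_iUnion (S.failureAt_disjoint X r k l)
    (hX.measurableSet_failureAt S r k l)]
  congr with n
  rw [← hX.measureReal_failureAt, ofReal_measureReal]

variable [IsProbabilityMeasure F]

theorem measureReal_survival_succ_zero_zero (hX : IsShockSequence P F X) (S : LoadLevels)
    (n : ℕ) : P.real (S.survival X (n + 1) 0 0) =
      (1 - tail F S.gamma) * P.real (S.survival X n 0 0) := by
  rw [LoadLevels.survival_succ_zero_zero, hX.measureReal_survival_inter S n 0 0 measurableSet_Iio,
    measureReal_Iio_eq_tail, mul_comm]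

theorem measureReal_survival_succ_succ_zero [IsProbabilityMeasure P] (hX : IsShockSequence P F X) (S : LoadLevels)
    (n k : ℕ) : P.real (S.survival X (n + 1) (k + 1) 0) =
      (1 - tail F S.gamma) * P.real (S.survival X n (k + 1) 0) +
        (tail F S.gamma - tail F S.beta) * P.real (S.survival X n k 0) := by
  rw [LoadLevels.survival_succ_succ_zero, measureReal_union,
    hX.measureReal_survival_inter S n _ _ measurableSet_Iio,
    hX.measureReal_survival_inter S n _ _ measurableSet_Ico,
    measureReal_Iio_eq_tail, measureReal_Ico_eq_tail F S.gamma_le_beta, mul_comm,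
    mul_comm (P.real (S.survival X n k 0))]
  · refine Set.disjoint_left.2 ?_
    rintro ω ⟨-, h1⟩ ⟨-, h2⟩
    exact absurd h2.1 (not_le.2 h1)
  · exact (hX.measurableSet_survival S n k 0).inter (hX.meas _ (by omega) measurableSet_Ico)

theorem measureReal_survival_succ_succ [IsProbabilityMeasure P] (hX : IsShockSequence P F X) (S : LoadLevels)
    (n k l : ℕ) : P.real (S.survival X (n + 1) k (l + 1)) =
      (1 - tail F S.beta) * P.real (S.survival X n k (l + 1)) +
        (tail F S.beta - tail F (S.level k l)) * P.real (S.survival X n k l) := by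
  rw [LoadLevels.survival_succ_succ, measureReal_union,
    hX.measureReal_survival_inter S n _ _ measurableSet_Iio,
    hX.measureReal_survival_inter S n _ _ measurableSet_Ico,
    measureReal_Iio_eq_tail, measureReal_Ico_eq_tail F (S.beta_le_level k l), mul_comm,
    mul_comm (P.real (S.survival X n k l))]
  · refine Set.disjoint_left.2 ?_
    rintro ω ⟨-, h1⟩ ⟨-, h2⟩
    exact absurd h2.1 (not_le.2 h1)
  · exact (hX.measurableSet_survival S n k l).inter (hX.meas _ (by omega) measurableSet_Ico)

end IsShockSequence

/-! ### Occupation times and the bound for the case `g = 0` -/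

/-- Summing the recursion over `n` telescopes: mass that has entered a state has either left it or
is still there. -/
theorem Nat.sum_range_succ_of_recursion {f g : ℕ → ℝ} {c d : ℝ} (h0 : f 0 = 0)
    (h : ∀ n, f (n + 1) = (1 - c) * f n + d * g n) (N : ℕ) :
    c * ∑ n ∈ Finset.range N, f n + f N = d * ∑ n ∈ Finset.range N, g n := by
  induction N with
  | zero => simp [h0]
  | succ N ih =>
    rw [Finset.sum_range_succ, Finset.sum_range_succ, mul_add, mul_add, ← ih, h]
    ring

namespace IsShockSequence

variable {Ω : Type*} [MeasurableSpace Ω] {P : Measure Ω} {F : Measure ℝ} {X : ℕ → Ω → ℝ}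
  [IsProbabilityMeasure P] [IsProbabilityMeasure F]

/-- The expected time in any state is at most `1 / p`. It is geometric for `(0, 0)`, and each
further state multiplies the bound by an entry rate over an exit rate, `(p - q) / p` or at most `q /
q`, hence by at most `1`. -/
theorem tail_gamma_mul_sum_survival_le (hX : IsShockSequence P F X) (S : LoadLevels)
    (hβ : 0 < tail F S.beta) (N k l : ℕ) :
    tail F S.gamma * ∑ n ∈ Finset.range N, P.real (S.survival X n k l) ≤ 1 := by
  have hgb : tail F S.beta ≤ tail F S.gamma := tail_anti F S.gamma_le_beta
  have hp : 0 < tail F S.gamma := hβ.trans_le hgb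
  induction l with
  | zero =>
    induction k with
    | zero =>
      suffices h : tail F S.gamma * ∑ n ∈ Finset.range N, P.real (S.survival X n 0 0) +
          P.real (S.survival X N 0 0) = 1 by
        linarith [measureReal_nonneg (μ := P) (s := S.survival X N 0 0)]
      induction N with
      | zero => simp [measureReal_survival_zero]
      | succ N ih =>
        rw [Finset.sum_range_succ, hX.measureReal_survival_succ_zero_zero]
        linear_combination ih
    | succ k ih =>
      have h := Nat.sum_range_succ_of_recursion
        (f := fun n => P.real (S.survival X n (k + 1) 0))
        (by simp [measureReal_survival_zero])
        (fun n => hX.measureReal_survival_succ_succ_zero S n k) N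
      have h1 : (tail F S.gamma - tail F S.beta) *
          ∑ n ∈ Finset.range N, P.real (S.survival X n k 0) ≤
          tail F S.gamma * ∑ n ∈ Finset.range N, P.real (S.survival X n k 0) :=
        mul_le_mul_of_nonneg_right (by linarith)
          (Finset.sum_nonneg fun _ _ => measureReal_nonneg)
      linarith [measureReal_nonneg (μ := P) (s := S.survival X N (k + 1) 0)]
  | succ l ih =>
    have h := Nat.sum_range_succ_of_recursion
      (f := fun n => P.real (S.survival X n k (l + 1)))
      (by simp [measureReal_survival_zero])
      (fun n => hX.measureReal_survival_succ_succ S n k l) N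
    have h1 : (tail F S.beta - tail F (S.level k l)) *
        ∑ n ∈ Finset.range N, P.real (S.survival X n k l) ≤
        tail F S.beta * ∑ n ∈ Finset.range N, P.real (S.survival X n k l) :=
      mul_le_mul_of_nonneg_right (by linarith [tail_nonneg F (S.level k l)])
        (Finset.sum_nonneg fun _ _ => measureReal_nonneg)
    have h2 : tail F S.beta * ∑ n ∈ Finset.range N, P.real (S.survival X n k (l + 1)) ≤
        tail F S.beta * ∑ n ∈ Finset.range N, P.real (S.survival X n k l) := by
      linarith [measureReal_nonneg (μ := P) (s := S.survival X N k (l + 1))]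
    exact (mul_le_mul_of_nonneg_left (le_of_mul_le_mul_left h2 hβ) hp.le).trans ih

/-- From state `(k, l)` a shock is fatal with probability at most `q`, and the expected time spent
there is at most `1 / p`. -/
theorem measureReal_failureEvent_le (hX : IsShockSequence P F X) (S : LoadLevels)
    (hβ : 0 < tail F S.beta) (r : ℝ) (k l : ℕ) :
    P.real (S.failureEvent X r k l) ≤ tail F S.beta / tail F S.gamma := by
  classical
  have hp : 0 < tail F S.gamma := hβ.trans_le (tail_anti F S.gamma_le_beta)
  refine ENNReal.toReal_le_of_le_ofReal (by positivity) ?_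
  rw [hX.measure_failureEvent, ENNReal.tsum_eq_iSup_nat]
  refine iSup_le fun N => ?_
  rw [← ENNReal.ofReal_sum_of_nonneg]
  · refine ENNReal.ofReal_le_ofReal ?_
    rw [le_div_iff₀ hp]
    calc _ ≤ (∑ n ∈ Finset.range N, P.real (S.survival X n k l) * tail F S.beta) *
          tail F S.gamma := by
          refine mul_le_mul_of_nonneg_right (Finset.sum_le_sum fun n _ => ?_) hp.le
          split_ifs
          · exact mul_le_mul_of_nonneg_left (tail_anti F (S.beta_le_level k l))
              measureReal_nonneg
          · exact mul_nonneg measureReal_nonneg hβ.le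
      _ = tail F S.beta *
          (tail F S.gamma * ∑ n ∈ Finset.range N, P.real (S.survival X n k l)) := by
          rw [← Finset.sum_mul]; ring
      _ ≤ tail F S.beta * 1 :=
          mul_le_mul_of_nonneg_left (hX.tail_gamma_mul_sum_survival_le S hβ N k l) hβ.le
      _ = _ := mul_one _
  · intro n _
    split_ifs
    · exact mul_nonneg measureReal_nonneg (tail_nonneg F _)
    · exact le_rfl

end IsShockSequence

/-! ### Elementary Poisson limits -/

section Limits

variable {ι : Type*} {L : Filter ι} {n : ι → ℕ} {p q : ι → ℝ} {u c : ℝ}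

theorem tendsto_natCast_sub_mul (hq0 : ∀ᶠ t in L, 0 ≤ q t) (hq : Tendsto q L (𝓝 0))
    (hn : Tendsto (fun t => (n t : ℝ) * q t) L (𝓝 u)) (k : ℕ) :
    Tendsto (fun t => ((n t - k : ℕ) : ℝ) * q t) L (𝓝 u) := by
  have h1 : Tendsto (fun t => (n t : ℝ) * q t - k * q t) L (𝓝 u) := by
    simpa using hn.sub (hq.const_mul (k : ℝ))
  refine tendsto_of_tendsto_of_tendsto_of_le_of_le' h1 hn ?_ ?_
  · filter_upwards [hq0] with t ht
    rw [← sub_mul]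
    refine mul_le_mul_of_nonneg_right ?_ ht
    rw [sub_le_iff_le_add]
    exact_mod_cast (by omega : n t ≤ n t - k + k)
  · filter_upwards [hq0] with t ht
    exact mul_le_mul_of_nonneg_right (by exact_mod_cast Nat.sub_le _ _) ht

theorem tendsto_pow_mul_choose (hq0 : ∀ᶠ t in L, 0 ≤ q t) (hq : Tendsto q L (𝓝 0))
    (hn : Tendsto (fun t => (n t : ℝ) * q t) L (𝓝 u)) (k : ℕ) :
    Tendsto (fun t => q t ^ k * ((n t).choose k : ℝ)) L (𝓝 (u ^ k / k.factorial)) := by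
  induction k with
  | zero => simpa using tendsto_const_nhds
  | succ k ih =>
    have h1 := tendsto_natCast_sub_mul hq0 hq hn k
    have h2 := (ih.mul h1).div_const ((k : ℝ) + 1)
    have e : u ^ k / k.factorial * u / ((k : ℝ) + 1) = u ^ (k + 1) / (k + 1).factorial := by
      rw [Nat.factorial_succ]; push_cast; field_simp; ring
    rw [e] at h2
    refine h2.congr fun t => ?_
    have h3 : ((n t).choose (k + 1) : ℝ) * (k + 1) = (n t).choose k * ((n t - k : ℕ) : ℝ) := by
      exact_mod_cast Nat.choose_succ_right_eq (n t) k
    rw [div_eq_iff (by positivity)]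
    linear_combination (-(q t ^ (k + 1))) * h3

/-- The power is squeezed between `exp (-n p / (1 - p))` and `exp (-n p)`. -/
theorem tendsto_one_sub_pow_exp (hp : Tendsto p L (𝓝 0))
    (hn : Tendsto (fun t => (n t : ℝ) * p t) L (𝓝 u)) :
    Tendsto (fun t => (1 - p t) ^ n t) L (𝓝 (Real.exp (-u))) := by
  have h1 : Tendsto (fun t => Real.exp (-((n t : ℝ) * p t / (1 - p t)))) L
      (𝓝 (Real.exp (-u))) := by
    refine (Real.continuous_exp.tendsto _).comp (Tendsto.neg ?_)
    have h := hn.div (hp.const_sub 1) (by norm_num)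
    rwa [sub_zero, div_one] at h
  have h2 : Tendsto (fun t => Real.exp (-((n t : ℝ) * p t))) L (𝓝 (Real.exp (-u))) :=
    (Real.continuous_exp.tendsto _).comp hn.neg
  have hp1 : ∀ᶠ t in L, p t < 1 := hp.eventually_lt_const one_pos
  refine tendsto_of_tendsto_of_tendsto_of_le_of_le' h1 h2 ?_ ?_
  · filter_upwards [hp1] with t ht1
    have h3 : 0 < 1 - p t := by linarith
    -- This is `1 + y ≤ exp y` at `y = p / (1 - p)`, for which `1 + y = 1 / (1 - p)`.
    have h4 : Real.exp (-(p t / (1 - p t))) ≤ 1 - p t := by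
      rw [Real.exp_neg, inv_le_comm₀ (Real.exp_pos _) h3]
      refine le_trans (le_of_eq ?_) (Real.add_one_le_exp _)
      field_simp
      ring
    calc _ = Real.exp (-(p t / (1 - p t))) ^ n t := by
          rw [← Real.exp_nat_mul]; congr 1; ring
      _ ≤ _ := pow_le_pow_left₀ (Real.exp_pos _).le h4 _
  · filter_upwards [hp1] with t ht1
    calc _ ≤ Real.exp (-p t) ^ n t :=
          pow_le_pow_left₀ (by linarith) (by linarith [Real.add_one_le_exp (-p t)]) _
      _ = _ := by rw [← Real.exp_nat_mul]; congr 1; ring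

end Limits

/-! ### Binomial weights, their convolution and uniform bounds -/

/-- The weight `C(n, k) (1 - p)^(n - k)`. -/
noncomputable def binomWeight (k : ℕ) (p : ℝ) (n : ℕ) : ℝ := n.choose k * (1 - p) ^ (n - k)

/-- The convolution of two binomial weights. -/
noncomputable def binomConv (k : ℕ) (p : ℝ) (l : ℕ) (q : ℝ) (n : ℕ) : ℝ :=
  ∑ j ∈ Finset.range n, binomWeight k p j * binomWeight l q (n - 1 - j)

theorem binomWeight_zero_succ (p : ℝ) (n : ℕ) :
    binomWeight 0 p (n + 1) = (1 - p) * binomWeight 0 p n := by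
  simp [binomWeight, pow_succ']

theorem binomWeight_succ_succ (k : ℕ) (p : ℝ) (n : ℕ) :
    binomWeight (k + 1) p (n + 1) = (1 - p) * binomWeight (k + 1) p n + binomWeight k p n := by
  rw [binomWeight, binomWeight, binomWeight, Nat.choose_succ_succ, Nat.add_sub_add_right]
  rcases Nat.lt_or_ge k n with h | h
  · obtain ⟨m, rfl⟩ : ∃ m, n = k + 1 + m := ⟨n - (k + 1), by omega⟩
    rw [show k + 1 + m - k = m + 1 by omega, Nat.add_sub_cancel_left]
    push_cast
    ring
  · rw [Nat.choose_eq_zero_of_lt (show n < k + 1 by omega)]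
    simp

theorem binomWeight_nonneg (k : ℕ) {p : ℝ} (hp : p ≤ 1) (n : ℕ) : 0 ≤ binomWeight k p n :=
  mul_nonneg (Nat.cast_nonneg _) (pow_nonneg (by linarith) _)

theorem binomConv_nonneg (k l : ℕ) {p q : ℝ} (hp : p ≤ 1) (hq : q ≤ 1) (n : ℕ) :
    0 ≤ binomConv k p l q n :=
  Finset.sum_nonneg fun _ _ => mul_nonneg (binomWeight_nonneg k hp _) (binomWeight_nonneg l hq _)

/-- The last summand `j = n` is the one where the first weakening happens at the newest shock; its
second factor is `1`. For larger second index, as in `binomConv_succ_succ`, that factor vanishes. -/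
theorem binomConv_zero_succ (k : ℕ) (p q : ℝ) (n : ℕ) :
    binomConv k p 0 q (n + 1) = (1 - q) * binomConv k p 0 q n + binomWeight k p n := by
  rw [binomConv, binomConv, Finset.sum_range_succ, Finset.mul_sum]
  congr 1
  · refine Finset.sum_congr rfl fun j hj => ?_
    rw [Finset.mem_range] at hj
    rw [show n + 1 - 1 - j = n - 1 - j + 1 by omega, binomWeight_zero_succ]
    ring
  · simp [binomWeight]

theorem binomConv_succ_succ (k : ℕ) (p : ℝ) (l : ℕ) (q : ℝ) (n : ℕ) :
    binomConv k p (l + 1) q (n + 1) =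
      (1 - q) * binomConv k p (l + 1) q n + binomConv k p l q n := by
  rw [binomConv, binomConv, binomConv, Finset.sum_range_succ, Finset.mul_sum,
    ← Finset.sum_add_distrib]
  have h : binomWeight (l + 1) q (n + 1 - 1 - n) = 0 := by simp [binomWeight]
  rw [h, mul_zero, add_zero]
  refine Finset.sum_congr rfl fun j hj => ?_
  rw [Finset.mem_range] at hj
  rw [show n + 1 - 1 - j = n - 1 - j + 1 by omega, binomWeight_succ_succ]
  ring

/-- The bound follows from `C(n,k) ≤ n^k` and `1 - p ≤ exp (-q)`; the missing `k` factors cost at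
most `exp k` as `q ≤ 1`. Using `q` instead of `p` on the right gives a majorant in the single
variable `n q`. -/
theorem pow_mul_binomWeight_le (k : ℕ) {p q : ℝ} (hq : 0 ≤ q) (hqp : q ≤ p) (hp : p ≤ 1)
    (n : ℕ) :
    q ^ k * binomWeight k p n ≤ Real.exp k * (((n : ℝ) * q) ^ k * Real.exp (-((n : ℝ) * q))) := by
  rcases Nat.lt_or_ge n k with h | h
  · rw [binomWeight, Nat.choose_eq_zero_of_lt h]
    simp only [Nat.cast_zero, zero_mul, mul_zero]
    positivity
  · have h1 : (n.choose k : ℝ) ≤ (n : ℝ) ^ k := by exact_mod_cast Nat.choose_le_pow n k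
    have h2 : (1 - p) ^ (n - k) ≤ Real.exp k * Real.exp (-((n : ℝ) * q)) := by
      calc (1 - p) ^ (n - k) ≤ Real.exp (-q) ^ (n - k) :=
            pow_le_pow_left₀ (by linarith) (by linarith [Real.add_one_le_exp (-q)]) _
        _ = Real.exp (k * q + -(n * q)) := by
            rw [← Real.exp_nat_mul, Nat.cast_sub h]; congr 1; ring
        _ ≤ Real.exp (k + -(n * q)) := by
            rw [Real.exp_le_exp]
            have : (k : ℝ) * q ≤ k * 1 :=
              mul_le_mul_of_nonneg_left (hqp.trans hp) (Nat.cast_nonneg _)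
            linarith
        _ = _ := Real.exp_add _ _
    calc q ^ k * binomWeight k p n
        ≤ q ^ k * ((n : ℝ) ^ k * (Real.exp k * Real.exp (-((n : ℝ) * q)))) := by
          refine mul_le_mul_of_nonneg_left ?_ (by positivity)
          exact mul_le_mul h1 h2 (pow_nonneg (by linarith) _) (by positivity)
      _ = _ := by rw [mul_pow]; ring

theorem pow_mul_binomConv_eq (k l : ℕ) (p q : ℝ) (n : ℕ) :
    q ^ (k + l + 1) * binomConv k p l q n = q * ∑ j ∈ Finset.range n,
      (q ^ k * binomWeight k p j) * (q ^ l * binomWeight l q (n - 1 - j)) := by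
  rw [binomConv, Finset.mul_sum, Finset.mul_sum]
  exact Finset.sum_congr rfl fun j _ => by ring

/-- Each summand is bounded independently of `j`, since the exponentials at `j` and `n - 1 - j`
multiply to that at `n - 1`. The `n` summands and the prefactor `q` supply one more power of `n q`;
passing from `n - 1` to `n` costs `exp q ≤ exp 1`. -/
theorem pow_mul_binomConv_le (k l : ℕ) {p q : ℝ} (hq : 0 ≤ q) (hqp : q ≤ p) (hp : p ≤ 1)
    (n : ℕ) :
    q ^ (k + l + 1) * binomConv k p l q n ≤
      Real.exp (k + l + 1) * (((n : ℝ) * q) ^ (k + l + 1) * Real.exp (-((n : ℝ) * q))) := by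
  have hq1 : q ≤ 1 := hqp.trans hp
  rw [pow_mul_binomConv_eq]
  have key : ∀ j ∈ Finset.range n,
      (q ^ k * binomWeight k p j) * (q ^ l * binomWeight l q (n - 1 - j)) ≤
      Real.exp (k + l + 1) * (((n : ℝ) * q) ^ (k + l) * Real.exp (-((n : ℝ) * q))) := by
    intro j hj
    rw [Finset.mem_range] at hj
    have hj' : (j : ℝ) ≤ n := by exact_mod_cast hj.le
    have hi : ((n - 1 - j : ℕ) : ℝ) = n - 1 - j := by
      rw [Nat.sub_sub, Nat.cast_sub (by omega)]; push_cast; ring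
    have hi' : ((n - 1 - j : ℕ) : ℝ) ≤ n := by exact_mod_cast (by omega : n - 1 - j ≤ n)
    calc _ ≤ (Real.exp k * (((j : ℝ) * q) ^ k * Real.exp (-((j : ℝ) * q)))) *
          (Real.exp l * ((((n - 1 - j : ℕ) : ℝ) * q) ^ l *
            Real.exp (-(((n - 1 - j : ℕ) : ℝ) * q)))) :=
          mul_le_mul (pow_mul_binomWeight_le k hq hqp hp j)
            (pow_mul_binomWeight_le l hq le_rfl hq1 _)
            (mul_nonneg (by positivity) (binomWeight_nonneg l hq1 _)) (by positivity)
      _ ≤ (Real.exp k * (((n : ℝ) * q) ^ k * Real.exp (-((j : ℝ) * q)))) *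
          (Real.exp l * (((n : ℝ) * q) ^ l * Real.exp (-(((n - 1 - j : ℕ) : ℝ) * q)))) := by
          gcongr
      _ = Real.exp (k + l + q) * (((n : ℝ) * q) ^ (k + l) * Real.exp (-((n : ℝ) * q))) := by
          have : Real.exp k * Real.exp l * (Real.exp (-((j : ℝ) * q)) *
              Real.exp (-(((n - 1 - j : ℕ) : ℝ) * q))) =
              Real.exp (k + l + q) * Real.exp (-((n : ℝ) * q)) := by
            simp only [← Real.exp_add, hi]
            congr 1; ring
          rw [pow_add]
          linear_combination (((n : ℝ) * q) ^ k * ((n : ℝ) * q) ^ l) * this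
      _ ≤ _ := by gcongr
  calc _ ≤ q * ∑ j ∈ Finset.range n,
        Real.exp (k + l + 1) * (((n : ℝ) * q) ^ (k + l) * Real.exp (-((n : ℝ) * q))) :=
        mul_le_mul_of_nonneg_left (Finset.sum_le_sum key) hq
    _ = _ := by
        rw [Finset.sum_const, Finset.card_range, nsmul_eq_mul]; ring

section Limits

variable {ι : Type*} {L : Filter ι} {n : ι → ℕ} {p q : ι → ℝ} {u c : ℝ}

theorem tendsto_pow_mul_binomWeight (hq0 : ∀ᶠ t in L, 0 < q t) (hq : Tendsto q L (𝓝 0))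
    (hpq : Tendsto (fun t => p t / q t) L (𝓝 c))
    (hn : Tendsto (fun t => (n t : ℝ) * q t) L (𝓝 u)) (k : ℕ) :
    Tendsto (fun t => q t ^ k * binomWeight k (p t) (n t)) L
      (𝓝 (u ^ k / k.factorial * Real.exp (-(u * c)))) := by
  have hq0' : ∀ᶠ t in L, 0 ≤ q t := hq0.mono fun _ h => h.le
  have hp : Tendsto p L (𝓝 0) := by
    have := hpq.mul hq
    rw [mul_zero] at this
    refine this.congr' ?_
    filter_upwards [hq0] with t ht using div_mul_cancel₀ _ ht.ne'
  have hm : Tendsto (fun t => ((n t - k : ℕ) : ℝ) * p t) L (𝓝 (u * c)) := by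
    refine ((tendsto_natCast_sub_mul hq0' hq hn k).mul hpq).congr' ?_
    filter_upwards [hq0] with t ht
    field_simp
  refine ((tendsto_pow_mul_choose hq0' hq hn k).mul
    (tendsto_one_sub_pow_exp hp hm)).congr fun t => ?_
  rw [binomWeight, mul_assoc]

end Limits

/-! ### Sums as integrals of step functions, and their limits -/

theorem map_natFloor_restrict_Ici :
    Measure.map (fun x : ℝ => ⌊x⌋₊) (volume.restrict (Set.Ici (0 : ℝ))) =
      (Measure.count : Measure ℕ) := by
  refine Measure.ext_of_singleton fun n => ?_
  rw [Measure.map_apply Nat.measurable_floor (measurableSet_singleton n),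
    Measure.restrict_apply (Nat.measurable_floor (measurableSet_singleton n)),
    Measure.count_singleton]
  have : (fun x : ℝ => ⌊x⌋₊) ⁻¹' {n} ∩ Set.Ici 0 = Set.Ico (n : ℝ) (n + 1) := by
    ext x
    simp only [Set.mem_inter_iff, Set.mem_preimage, Set.mem_singleton_iff, Set.mem_Ici,
      Set.mem_Ico]
    constructor
    · rintro ⟨h, h0⟩
      exact (Nat.floor_eq_iff h0).1 h
    · intro h
      have h0 : 0 ≤ x := (Nat.cast_nonneg n).trans h.1
      exact ⟨(Nat.floor_eq_iff h0).2 h, h0⟩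
  rw [this, Real.volume_Ico]
  simp

theorem integral_Ioi_comp_natFloor_mul (φ : ℕ → ℝ) {r : ℝ} (hr : 0 < r) :
    ∫ x in Set.Ioi (0 : ℝ), φ ⌊r * x⌋₊ = r⁻¹ * ∫ n, φ n ∂Measure.count := by
  have h := integral_comp_mul_left_Ioi (fun x => φ ⌊x⌋₊) 0 hr
  rw [h, mul_zero, smul_eq_mul, ← integral_Ici_eq_integral_Ioi, ← map_natFloor_restrict_Ici,
    integral_map Nat.measurable_floor.aemeasurable
      (Measurable.of_discrete.aestronglyMeasurable)]

/-- Rewriting the sum as an integral over a fixed interval allows dominated convergence while `n`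
tends to infinity. -/
theorem sum_range_eq_integral (φ : ℕ → ℝ) {n : ℕ} (hn : 0 < n) :
    ∑ j ∈ Finset.range n, φ j = n * ∫ y in Set.Ioo (0 : ℝ) 1, φ ⌊(n : ℝ) * y⌋₊ := by
  have hn' : (0 : ℝ) < n := by exact_mod_cast hn
  have h := integral_Ioi_comp_natFloor_mul ((Set.Iio n).indicator φ) hn'
  have h1 : ∫ j, (Set.Iio n).indicator φ j ∂Measure.count = ∑ j ∈ Finset.range n, φ j := by
    rw [integral_indicator (measurableSet_Iio), ← Finset.coe_range, setIntegral_finset]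
    · simp
    · rw [← Set.biUnion_of_singleton (Finset.range n : Set ℕ)]
      exact integrableOn_finset_iUnion.2 fun j _ => integrableOn_singleton (by simp)
        (by rw [Measure.count_singleton]; exact ENNReal.one_lt_top)
  have h2 : ∫ x in Set.Ioi (0 : ℝ), (Set.Iio n).indicator φ ⌊(n : ℝ) * x⌋₊ =
      ∫ y in Set.Ioo (0 : ℝ) 1, φ ⌊(n : ℝ) * y⌋₊ := by
    rw [← Set.Ioi_inter_Iio, ← setIntegral_indicator measurableSet_Iio]
    refine setIntegral_congr_fun measurableSet_Ioi fun x (hx : 0 < x) => ?_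
    have : ⌊(n : ℝ) * x⌋₊ < n ↔ x < 1 := by
      rw [Nat.floor_lt (by positivity)]
      exact mul_lt_iff_lt_one_right hn'
    by_cases hx1 : x < 1
    · simp [Set.indicator, this, hx1]
    · simp [Set.indicator, this, hx1]
  rw [← h2, h, h1, mul_inv_cancel_left₀ hn'.ne']

section Limits

variable {ι : Type*} {L : Filter ι} {n : ι → ℕ} {p q : ι → ℝ} {u c : ℝ}

theorem tendsto_natFloor_mul_mul {v : ι → ℝ} (hv0 : ∀ᶠ t in L, 0 ≤ v t)
    (hq0 : ∀ᶠ t in L, 0 < q t) (hq : Tendsto q L (𝓝 0))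
    (hv : Tendsto (fun t => v t * q t) L (𝓝 u)) :
    Tendsto (fun t => (⌊v t⌋₊ : ℝ) * q t) L (𝓝 u) := by
  have h1 : Tendsto (fun t => v t * q t - q t) L (𝓝 u) := by simpa using hv.sub hq
  refine tendsto_of_tendsto_of_tendsto_of_le_of_le' h1 hv ?_ ?_
  · filter_upwards [hq0] with t ht
    have := Nat.lt_floor_add_one (v t)
    nlinarith
  · filter_upwards [hq0, hv0] with t ht ht'
    exact mul_le_mul_of_nonneg_right (Nat.floor_le ht') ht.le

/-- The convolution is a Riemann sum with `j ≈ n y`. The first factor has rate ratio `p / q → c`,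
the second `q / q = 1`, which explains the `c` and the `1` in the exponents. -/
theorem tendsto_pow_mul_binomConv [L.IsCountablyGenerated] (hu : 0 < u)
    (hq0 : ∀ᶠ t in L, 0 < q t) (hq : Tendsto q L (𝓝 0))
    (hqp : ∀ᶠ t in L, q t ≤ p t) (hp1 : ∀ᶠ t in L, p t ≤ 1)
    (hpq : Tendsto (fun t => p t / q t) L (𝓝 c))
    (hn : Tendsto (fun t => (n t : ℝ) * q t) L (𝓝 u)) (k l : ℕ) :
    Tendsto (fun t => q t ^ (k + l + 1) * binomConv k (p t) l (q t) (n t)) L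
      (𝓝 (u * ∫ y in Set.Ioo (0 : ℝ) 1, ((u * y) ^ k / k.factorial * Real.exp (-(u * y * c))) *
        ((u * (1 - y)) ^ l / l.factorial * Real.exp (-(u * (1 - y) * 1))))) := by
  have hn0 : ∀ᶠ t in L, 0 < n t := by
    filter_upwards [hn.eventually_const_lt hu] with t ht
    rcases Nat.eq_zero_or_pos (n t) with h | h
    · simp [h] at ht
    · exact h
  have hnu : ∀ᶠ t in L, (n t : ℝ) * q t ≤ u + 1 :=
    (hn.eventually_lt_const (lt_add_one u)).mono fun _ h => h.le
  have hqq : Tendsto (fun t => q t / q t) L (𝓝 1) :=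
    tendsto_const_nhds.congr' (by filter_upwards [hq0] with t ht using (div_self ht.ne').symm)
  have key : Tendsto (fun t => ∫ y in Set.Ioo (0 : ℝ) 1,
      (q t ^ k * binomWeight k (p t) ⌊(n t : ℝ) * y⌋₊) *
      (q t ^ l * binomWeight l (q t) (n t - 1 - ⌊(n t : ℝ) * y⌋₊))) L
      (𝓝 (∫ y in Set.Ioo (0 : ℝ) 1, ((u * y) ^ k / k.factorial * Real.exp (-(u * y * c))) *
        ((u * (1 - y)) ^ l / l.factorial * Real.exp (-(u * (1 - y) * 1))))) := by
    -- Eventually `n q ≤ u + 1`, so on the unit interval a constant majorant suffices.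
    refine tendsto_integral_filter_of_dominated_convergence
      (fun _ => (Real.exp k * (u + 1) ^ k) * (Real.exp l * (u + 1) ^ l)) ?_ ?_ ?_ ?_
    · refine Eventually.of_forall fun t => ?_
      have hf : Measurable fun y : ℝ => ⌊(n t : ℝ) * y⌋₊ :=
        Nat.measurable_floor.comp (measurable_const_mul _)
      exact ((Measurable.of_discrete (f := fun j : ℕ => (q t ^ k * binomWeight k (p t) j) *
        (q t ^ l * binomWeight l (q t) (n t - 1 - j)))).comp hf).aestronglyMeasurable
    · filter_upwards [hq0, hqp, hp1, hnu, hn0] with t ht0 ht1 ht2 ht3 ht4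
      refine (ae_restrict_iff' measurableSet_Ioo).2 (Eventually.of_forall fun y hy => ?_)
      have hb : ∀ (m : ℕ) (r : ℝ) (j : ℕ), q t ≤ r → r ≤ 1 → j ≤ n t →
          q t ^ m * binomWeight m r j ≤ Real.exp m * (u + 1) ^ m := by
        intro m r j h1 h2 h3
        refine (pow_mul_binomWeight_le m ht0.le h1 h2 j).trans ?_
        have h4 : (j : ℝ) * q t ≤ u + 1 :=
          (mul_le_mul_of_nonneg_right (by exact_mod_cast h3) ht0.le).trans ht3
        have h5 : Real.exp (-((j : ℝ) * q t)) ≤ 1 := Real.exp_le_one_iff.2 (by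
          have : 0 ≤ (j : ℝ) * q t := by positivity
          linarith)
        calc _ ≤ Real.exp m * ((u + 1) ^ m * 1) := by gcongr
          _ = _ := by rw [mul_one]
      have hfl : ⌊(n t : ℝ) * y⌋₊ ≤ n t := Nat.floor_le_of_le
        (mul_le_of_le_one_right (Nat.cast_nonneg _) hy.2.le)
      have hA := mul_nonneg (pow_nonneg ht0.le k) (binomWeight_nonneg k ht2 ⌊(n t : ℝ) * y⌋₊)
      have hB := mul_nonneg (pow_nonneg ht0.le l)
        (binomWeight_nonneg l (ht1.trans ht2) (n t - 1 - ⌊(n t : ℝ) * y⌋₊))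
      rw [Real.norm_of_nonneg (mul_nonneg hA hB)]
      exact mul_le_mul (hb k _ _ ht1 ht2 hfl) (hb l _ _ le_rfl (ht1.trans ht2) (by omega)) hB
        (by positivity)
    · exact integrable_const _
    · refine (ae_restrict_iff' measurableSet_Ioo).2 (Eventually.of_forall fun y hy => ?_)
      have h1 : Tendsto (fun t => (⌊(n t : ℝ) * y⌋₊ : ℝ) * q t) L (𝓝 (u * y)) := by
        refine tendsto_natFloor_mul_mul
          (Eventually.of_forall fun t => mul_nonneg (Nat.cast_nonneg _) hy.1.le) hq0 hq ?_
        refine (hn.mul_const y).congr fun t => by ring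
      have h2 : Tendsto (fun t => ((n t - 1 - ⌊(n t : ℝ) * y⌋₊ : ℕ) : ℝ) * q t) L
          (𝓝 (u * (1 - y))) := by
        have h3 := (hn.sub hq).sub h1
        rw [show u - 0 - u * y = u * (1 - y) by ring] at h3
        refine h3.congr' ?_
        filter_upwards [hn0] with t ht
        have ht' : (0 : ℝ) < n t := by exact_mod_cast ht
        have : ⌊(n t : ℝ) * y⌋₊ < n t :=
          (Nat.floor_lt (mul_nonneg ht'.le hy.1.le)).2 ((mul_lt_iff_lt_one_right ht').2 hy.2)
        rw [Nat.sub_sub, Nat.cast_sub (by omega)]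
        push_cast
        ring
      exact (tendsto_pow_mul_binomWeight hq0 hq hpq h1 k).mul
        (tendsto_pow_mul_binomWeight hq0 hq hqq h2 l)
  refine (hn.mul key).congr' ?_
  filter_upwards [hn0] with t ht
  rw [pow_mul_binomConv_eq, sum_range_eq_integral (fun j => (q t ^ k * binomWeight k (p t) j) *
    (q t ^ l * binomWeight l (q t) (n t - 1 - j))) ht]
  ring

/-- Dominated convergence for Riemann sums over `[z, ∞)` with mesh `q`. -/
theorem tendsto_integral_natFloor [L.IsCountablyGenerated] {z : ℝ} (hz : 0 ≤ z)
    (hq0 : ∀ᶠ t in L, 0 < q t) (hq : Tendsto q L (𝓝 0))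
    {f : ι → ℕ → ℝ} {h : ℝ → ℝ} {C : ℝ} {m : ℕ}
    (hf : ∀ᶠ t in L, ∀ n : ℕ,
      |f t n| ≤ C * (((n : ℝ) * q t) ^ m * Real.exp (-((n : ℝ) * q t))))
    (hlim : ∀ u, 0 < u → Tendsto (fun t => f t ⌊(q t)⁻¹ * u⌋₊) L (𝓝 (h u))) :
    Tendsto (fun t => ∫ u in Set.Ioi (0 : ℝ),
      {n : ℕ | z / q t ≤ (n : ℝ) + 1}.indicator (f t) ⌊(q t)⁻¹ * u⌋₊) L
      (𝓝 (∫ u in Set.Ioi z, h u)) := by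
  have hzI : ∫ u in Set.Ioi z, h u = ∫ u in Set.Ioi (0 : ℝ), (Set.Ioi z).indicator h u := by
    rw [setIntegral_indicator measurableSet_Ioi, Set.Ioi_inter_Ioi, sup_eq_right.2 hz]
  have hq1 : ∀ᶠ t in L, q t ≤ 1 := (hq.eventually_lt_const one_pos).mono fun _ h => h.le
  rw [hzI]
  refine tendsto_integral_filter_of_dominated_convergence
    (fun u => |C| * Real.exp 1 * (Real.exp (-u) * u ^ m)) ?_ ?_ ?_ ?_
  · refine Eventually.of_forall fun t => ?_
    have hf : Measurable fun y : ℝ => ⌊(q t)⁻¹ * y⌋₊ :=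
      Nat.measurable_floor.comp (measurable_const_mul _)
    exact ((Measurable.of_discrete
      (f := {n : ℕ | z / q t ≤ (n : ℝ) + 1}.indicator (f t))).comp hf).aestronglyMeasurable
  · filter_upwards [hq0, hq1, hf] with t ht0 ht1 ht2
    refine (ae_restrict_iff' measurableSet_Ioi).2 (Eventually.of_forall fun u (hu : 0 < u) => ?_)
    refine (norm_indicator_le_norm_self _ _).trans ?_
    rw [Real.norm_eq_abs]
    refine (ht2 _).trans ?_
    set n := ⌊(q t)⁻¹ * u⌋₊
    -- The rounded point `n q` lies in `[u - 1, u]` because the mesh is at most `1`. The polynomial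
    -- factor is thus bounded at `u`, and the exponential loses at most a factor `exp 1`.
    have h1 : (n : ℝ) * q t ≤ u := by
      have := mul_le_mul_of_nonneg_right (Nat.floor_le (show 0 ≤ (q t)⁻¹ * u by positivity)) ht0.le
      rwa [mul_right_comm, inv_mul_cancel₀ ht0.ne', one_mul] at this
    have h2 : u - 1 ≤ (n : ℝ) * q t := by
      have := mul_lt_mul_of_pos_right (Nat.lt_floor_add_one ((q t)⁻¹ * u)) ht0
      rw [mul_right_comm, inv_mul_cancel₀ ht0.ne', one_mul, add_mul] at this
      linarith
    calc _ ≤ |C| * (u ^ m * Real.exp (1 + -u)) := by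
          refine mul_le_mul (le_abs_self C) ?_ (by positivity) (abs_nonneg _)
          refine mul_le_mul (pow_le_pow_left₀ (by positivity) h1 m) ?_ (by positivity)
            (by positivity)
          rw [Real.exp_le_exp]; linarith
      _ = _ := by rw [Real.exp_add]; ring
  · refine Integrable.const_mul ?_ _
    have := Real.GammaIntegral_convergent (s := (m : ℝ) + 1) (by positivity)
    simp only [add_sub_cancel_right, Real.rpow_natCast] at this
    exact this
  -- At `u = z` the rounded cutoff need not converge, but a single point is null. Away from `z`, `(n
  -- + 1) q` lies in `(u, u + q]`, so the cutoff is eventually decided by the side of `z` on which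
  -- `u` lies.
  · have hne : ∀ᵐ u : ℝ ∂volume.restrict (Set.Ioi 0), u ≠ z := Measure.ae_ne _ z
    filter_upwards [hne, ae_restrict_mem measurableSet_Ioi] with u huz (hu : 0 < u)
    rcases lt_or_gt_of_ne huz with h1 | h1
    · rw [Set.indicator_of_notMem (by simpa using h1.le)]
      refine tendsto_const_nhds.congr' ?_
      filter_upwards [hq0, hq.eventually_lt_const (sub_pos.2 h1)] with t ht0 ht1
      rw [Set.indicator_of_notMem]
      simp only [Set.mem_ofPred_eq, not_le]
      have := Nat.floor_le (show 0 ≤ (q t)⁻¹ * u by positivity)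
      refine (add_le_add_left this 1).trans_lt ?_
      rw [lt_div_iff₀ ht0, add_mul, mul_right_comm, inv_mul_cancel₀ ht0.ne']
      linarith
    · rw [Set.indicator_of_mem (show u ∈ Set.Ioi z from h1)]
      refine (hlim u hu).congr' ?_
      filter_upwards [hq0] with t ht0
      rw [Set.indicator_of_mem]
      simp only [Set.mem_ofPred_eq]
      refine le_trans ?_ (Nat.lt_floor_add_one ((q t)⁻¹ * u)).le
      rw [div_le_iff₀ ht0, mul_right_comm, inv_mul_cancel₀ ht0.ne']
      linarith

end Limits

/-! ### Explicit survival probabilities and limits of the failure probabilities -/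

namespace IsShockSequence

variable {Ω : Type*} [MeasurableSpace Ω] {P : Measure Ω} {F : Measure ℝ} {X : ℕ → Ω → ℝ}

/-- The tail at the critical level is written as `q` times a ratio; the factor `q` is absorbed as
the mesh of the step function. -/
theorem measureReal_failureEvent_eq_integral [IsProbabilityMeasure P] (hX : IsShockSequence P F X) (S : LoadLevels)
    (hβ : 0 < tail F S.beta) (r : ℝ) (k l : ℕ) :
    P.real (S.failureEvent X r k l) = ∫ u in Set.Ioi (0 : ℝ), {n : ℕ | r ≤ (n : ℝ) + 1}.indicator
      (fun n => P.real (S.survival X n k l) * (tail F (S.level k l) / tail F S.beta))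
        ⌊(tail F S.beta)⁻¹ * u⌋₊ := by
  classical
  rw [integral_Ioi_comp_natFloor_mul _ (inv_pos.2 hβ), inv_inv, ← integral_const_mul,
    integral_eq_lintegral_of_nonneg_ae, lintegral_count, measureReal_def, hX.measure_failureEvent]
  · congr with n
    congr 1
    rw [Set.indicator_apply]
    simp only [Set.mem_ofPred_eq]
    split_ifs
    · field_simp
    · rw [mul_zero]
  · refine Eventually.of_forall fun n => mul_nonneg hβ.le (Set.indicator_nonneg (fun n _ => ?_) _)
    exact mul_nonneg measureReal_nonneg (div_nonneg (tail_nonneg F _) hβ.le)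
  · exact Measurable.of_discrete.aestronglyMeasurable

variable [IsProbabilityMeasure P] [IsProbabilityMeasure F]

theorem measureReal_survival_eq_binomWeight (hX : IsShockSequence P F X) (S : LoadLevels)
    (n k : ℕ) : P.real (S.survival X n k 0) =
      (tail F S.gamma - tail F S.beta) ^ k * binomWeight k (tail F S.gamma) n := by
  induction n generalizing k with
  | zero => cases k <;> simp [measureReal_survival_zero, binomWeight]
  | succ n ih =>
    cases k with
    | zero => rw [hX.measureReal_survival_succ_zero_zero, ih, binomWeight_zero_succ]; ring
    | succ k => rw [hX.measureReal_survival_succ_succ_zero, ih, ih, binomWeight_succ_succ]; ring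

/-- Split at the first weakening shock: before it come `k` strengthening shocks among `j` trials
with idle probability `1 - p`, after it `l` further weakenings among `n - 1 - j` trials with idle
probability `1 - q`. Since `k` is already final at the split, only the levels with this `k` enter
the product. -/
theorem measureReal_survival_eq_binomConv (hX : IsShockSequence P F X) (S : LoadLevels)
    (n k l : ℕ) : P.real (S.survival X n k (l + 1)) =
      (tail F S.gamma - tail F S.beta) ^ k *
        (∏ h ∈ Finset.range (l + 1), (tail F S.beta - tail F (S.level k h))) *
        binomConv k (tail F S.gamma) l (tail F S.beta) n := by
  induction n generalizing l with
  | zero => simp [measureReal_survival_zero, binomConv]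
  | succ n ih =>
    rw [hX.measureReal_survival_succ_succ, ih]
    cases l with
    | zero =>
      rw [hX.measureReal_survival_eq_binomWeight, binomConv_zero_succ, Finset.prod_range_one]
      ring
    | succ l =>
      rw [ih, binomConv_succ_succ, Finset.prod_range_succ _ (l + 1)]
      ring

variable {ι : Type*} {L : Filter ι} [L.IsCountablyGenerated] {z c : ℝ}

theorem tendsto_failureEvent_zero (hX : IsShockSequence P F X) (S : ι → LoadLevels)
    (hβ : Tendsto (fun t => tail F (S t).beta) L (𝓝 0))
    (hβ0 : ∀ᶠ t in L, 0 < tail F (S t).beta)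
    (hc : Tendsto (fun t => tail F (S t).gamma / tail F (S t).beta) L (𝓝 c)) (k : ℕ) {a : ℝ}
    (ha : Tendsto (fun t => tail F ((S t).level k 0) / tail F (S t).beta) L (𝓝 a))
    (hz : 0 ≤ z) :
    Tendsto (fun t => P.real ((S t).failureEvent X (z / tail F (S t).beta) k 0)) L
      (𝓝 (∫ u in Set.Ioi z, (c - 1) ^ k * (u ^ k / k.factorial * Real.exp (-(u * c))) * a)) := by
  have heq : ∀ᶠ t in L, ∀ n : ℕ, P.real ((S t).survival X n k 0) *
      (tail F ((S t).level k 0) / tail F (S t).beta) =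
      (tail F (S t).gamma / tail F (S t).beta - 1) ^ k *
        (tail F (S t).beta ^ k * binomWeight k (tail F (S t).gamma) n) *
        (tail F ((S t).level k 0) / tail F (S t).beta) := by
    filter_upwards [hβ0] with t ht n
    rw [hX.measureReal_survival_eq_binomWeight, div_sub_one ht.ne', div_pow]
    field_simp
  have hlim := tendsto_integral_natFloor (L := L) (m := k)
    (q := fun t => tail F (S t).beta)
    (f := fun t n => P.real ((S t).survival X n k 0) *
      (tail F ((S t).level k 0) / tail F (S t).beta))
    (h := fun u => (c - 1) ^ k * (u ^ k / k.factorial * Real.exp (-(u * c))) * a)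
    (C := c ^ k * Real.exp k) hz hβ0 hβ ?_ ?_
  · refine hlim.congr' ?_
    filter_upwards [hβ0] with t ht
    rw [hX.measureReal_failureEvent_eq_integral (S t) ht]
  -- Eventually `p / q < c + 1`, so `(p / q - 1)^k ≤ c^k`; this is the origin of the constant in the
  -- majorant.
  · filter_upwards [hβ0, heq, hc.eventually_lt_const (lt_add_one c)] with t ht0 ht1 ht2 n
    have hqp : tail F (S t).beta ≤ tail F (S t).gamma := tail_anti F (S t).gamma_le_beta
    have h1 : 1 ≤ tail F (S t).gamma / tail F (S t).beta := (one_le_div ht0).2 hqp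
    have h2 : tail F ((S t).level k 0) / tail F (S t).beta ≤ 1 :=
      (div_le_one ht0).2 (tail_anti F ((S t).beta_le_level k 0))
    have h3 : 0 ≤ tail F ((S t).level k 0) / tail F (S t).beta :=
      div_nonneg (tail_nonneg F _) ht0.le
    rw [abs_of_nonneg (mul_nonneg measureReal_nonneg h3), ht1]
    have hw : 0 ≤ tail F (S t).beta ^ k * binomWeight k (tail F (S t).gamma) n :=
      mul_nonneg (pow_nonneg ht0.le k) (binomWeight_nonneg k (tail_le_one F _) n)
    have h4 : (tail F (S t).gamma / tail F (S t).beta - 1) ^ k ≤ c ^ k :=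
      pow_le_pow_left₀ (by linarith) (by linarith) k
    have h0 : 0 ≤ (tail F (S t).gamma / tail F (S t).beta - 1) ^ k :=
      pow_nonneg (by linarith) k
    calc _ ≤ (tail F (S t).gamma / tail F (S t).beta - 1) ^ k *
          (tail F (S t).beta ^ k * binomWeight k (tail F (S t).gamma) n) :=
          mul_le_of_le_one_right (mul_nonneg h0 hw) h2
      _ ≤ c ^ k * (Real.exp k * (((n : ℝ) * tail F (S t).beta) ^ k *
          Real.exp (-((n : ℝ) * tail F (S t).beta)))) :=
          mul_le_mul h4 (pow_mul_binomWeight_le k ht0.le hqp (tail_le_one F _) n) hw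
            (h0.trans h4)
      _ = _ := by ring
  · intro u hu
    have hn : Tendsto (fun t => (⌊(tail F (S t).beta)⁻¹ * u⌋₊ : ℝ) * tail F (S t).beta) L
        (𝓝 u) := by
      refine tendsto_natFloor_mul_mul
        (hβ0.mono fun t ht => mul_nonneg (inv_nonneg.2 ht.le) hu.le) hβ0 hβ
        (tendsto_const_nhds.congr' ?_)
      filter_upwards [hβ0] with t ht
      field_simp
    refine ((((hc.sub_const 1).pow k).mul
      (tendsto_pow_mul_binomWeight hβ0 hβ hc hn k)).mul ha).congr' ?_
    filter_upwards [heq] with t ht using (ht _).symm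

theorem tendsto_failureEvent_succ (hX : IsShockSequence P F X) (S : ι → LoadLevels)
    (hβ : Tendsto (fun t => tail F (S t).beta) L (𝓝 0))
    (hβ0 : ∀ᶠ t in L, 0 < tail F (S t).beta)
    (hc : Tendsto (fun t => tail F (S t).gamma / tail F (S t).beta) L (𝓝 c)) (k l : ℕ)
    {a : ℕ → ℝ}
    (ha : ∀ h, Tendsto (fun t => tail F ((S t).level k h) / tail F (S t).beta) L (𝓝 (a h)))
    (hz : 0 ≤ z) :
    Tendsto (fun t => P.real ((S t).failureEvent X (z / tail F (S t).beta) k (l + 1))) L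
      (𝓝 (∫ u in Set.Ioi z, (c - 1) ^ k * (∏ h ∈ Finset.range (l + 1), (1 - a h)) *
        (u * ∫ y in Set.Ioo (0 : ℝ) 1, ((u * y) ^ k / k.factorial * Real.exp (-(u * y * c))) *
        ((u * (1 - y)) ^ l / l.factorial * Real.exp (-(u * (1 - y) * 1)))) * a (l + 1))) := by
  -- Dividing `(p - q)^k` by `q^k` and the product by `q^(l + 1)` leaves convergent factors, and the
  -- freed power `q^(k + l + 1)` is exactly the scaling of the convolution.
  have heq : ∀ᶠ t in L, ∀ n : ℕ, P.real ((S t).survival X n k (l + 1)) *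
      (tail F ((S t).level k (l + 1)) / tail F (S t).beta) =
      (tail F (S t).gamma / tail F (S t).beta - 1) ^ k *
        (∏ h ∈ Finset.range (l + 1), (1 - tail F ((S t).level k h) / tail F (S t).beta)) *
        (tail F (S t).beta ^ (k + l + 1) *
          binomConv k (tail F (S t).gamma) l (tail F (S t).beta) n) *
        (tail F ((S t).level k (l + 1)) / tail F (S t).beta) := by
    filter_upwards [hβ0] with t ht n
    have hprod : ∏ h ∈ Finset.range (l + 1), (1 - tail F ((S t).level k h) / tail F (S t).beta) =
        (∏ h ∈ Finset.range (l + 1), (tail F (S t).beta - tail F ((S t).level k h))) /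
          tail F (S t).beta ^ (l + 1) := by
      rw [Finset.prod_congr rfl fun h _ => one_sub_div ht.ne', Finset.prod_div_distrib,
        Finset.prod_const, Finset.card_range]
    rw [hX.measureReal_survival_eq_binomConv, div_sub_one ht.ne', div_pow, hprod,
      show k + l + 1 = k + (l + 1) by ring, pow_add]
    field_simp
    ring
  have hlim := tendsto_integral_natFloor (L := L) (m := k + l + 1)
    (q := fun t => tail F (S t).beta)
    (f := fun t n => P.real ((S t).survival X n k (l + 1)) *
      (tail F ((S t).level k (l + 1)) / tail F (S t).beta))
    (h := fun u => (c - 1) ^ k * (∏ h ∈ Finset.range (l + 1), (1 - a h)) *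
        (u * ∫ y in Set.Ioo (0 : ℝ) 1, ((u * y) ^ k / k.factorial * Real.exp (-(u * y * c))) *
        ((u * (1 - y)) ^ l / l.factorial * Real.exp (-(u * (1 - y) * 1)))) * a (l + 1))
    (C := c ^ k * Real.exp (k + l + 1)) hz hβ0 hβ ?_ ?_
  · refine hlim.congr' ?_
    filter_upwards [hβ0] with t ht
    rw [hX.measureReal_failureEvent_eq_integral (S t) ht]
  · filter_upwards [hβ0, heq, hc.eventually_lt_const (lt_add_one c)] with t ht0 ht1 ht2 n
    have hqp : tail F (S t).beta ≤ tail F (S t).gamma := tail_anti F (S t).gamma_le_beta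
    have h1 : 1 ≤ tail F (S t).gamma / tail F (S t).beta := (one_le_div ht0).2 hqp
    have h2 : ∀ h, tail F ((S t).level k h) / tail F (S t).beta ≤ 1 := fun h =>
      (div_le_one ht0).2 (tail_anti F ((S t).beta_le_level k h))
    have h3 : ∀ h, 0 ≤ tail F ((S t).level k h) / tail F (S t).beta := fun h =>
      div_nonneg (tail_nonneg F _) ht0.le
    rw [abs_of_nonneg (mul_nonneg measureReal_nonneg (h3 _)), ht1]
    have hw : 0 ≤ tail F (S t).beta ^ (k + l + 1) *
        binomConv k (tail F (S t).gamma) l (tail F (S t).beta) n :=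
      mul_nonneg (pow_nonneg ht0.le _)
        (binomConv_nonneg k l (tail_le_one F _) (tail_le_one F _) n)
    have h4 : (tail F (S t).gamma / tail F (S t).beta - 1) ^ k ≤ c ^ k :=
      pow_le_pow_left₀ (by linarith) (by linarith) k
    have h0 : 0 ≤ (tail F (S t).gamma / tail F (S t).beta - 1) ^ k :=
      pow_nonneg (by linarith) k
    have h5 : 0 ≤ ∏ h ∈ Finset.range (l + 1),
        (1 - tail F ((S t).level k h) / tail F (S t).beta) :=
      Finset.prod_nonneg fun h _ => by linarith [h2 h]
    have h6 : ∏ h ∈ Finset.range (l + 1),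
        (1 - tail F ((S t).level k h) / tail F (S t).beta) ≤ 1 :=
      Finset.prod_le_one (fun h _ => by linarith [h2 h]) (fun h _ => by linarith [h3 h])
    calc _ ≤ (tail F (S t).gamma / tail F (S t).beta - 1) ^ k *
          (∏ h ∈ Finset.range (l + 1), (1 - tail F ((S t).level k h) / tail F (S t).beta)) *
          (tail F (S t).beta ^ (k + l + 1) *
            binomConv k (tail F (S t).gamma) l (tail F (S t).beta) n) :=
          mul_le_of_le_one_right (mul_nonneg (mul_nonneg h0 h5) hw) (h2 _)
      _ ≤ c ^ k * (Real.exp (k + l + 1) * (((n : ℝ) * tail F (S t).beta) ^ (k + l + 1) *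
          Real.exp (-((n : ℝ) * tail F (S t).beta)))) :=
          mul_le_mul ((mul_le_of_le_one_right h0 h6).trans h4)
            (pow_mul_binomConv_le k l ht0.le hqp (tail_le_one F _) n) hw (h0.trans h4)
      _ = _ := by ring
  · intro u hu
    have hn : Tendsto (fun t => (⌊(tail F (S t).beta)⁻¹ * u⌋₊ : ℝ) * tail F (S t).beta) L
        (𝓝 u) := by
      refine tendsto_natFloor_mul_mul
        (hβ0.mono fun t ht => mul_nonneg (inv_nonneg.2 ht.le) hu.le) hβ0 hβ
        (tendsto_const_nhds.congr' ?_)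
      filter_upwards [hβ0] with t ht
      field_simp
    refine (((((hc.sub_const 1).pow k).mul (tendsto_finsetProd _ fun h _ =>
      (ha h).const_sub 1)).mul (tendsto_pow_mul_binomConv hu hβ0 hβ
        (Eventually.of_forall fun t => tail_anti F (S t).gamma_le_beta)
        (Eventually.of_forall fun t => tail_le_one F _) hc hn k l)).mul (ha (l + 1))).congr' ?_
    filter_upwards [heq] with t ht using (ht _).symm

end IsShockSequence

/-! ### Matching the limits with the stated integrals -/

/-- Substitution `v = u / g`; its Jacobian is the isolated factor `g`. -/
theorem setIntegral_strengthening_eq {g : ℝ} (hg : 0 < g) {z : ℝ} (k : ℕ) (a : ℝ) :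
    ∫ u in Set.Ioi z, (g⁻¹ - 1) ^ k * (u ^ k / k.factorial * Real.exp (-(u * g⁻¹))) * a =
      (∫ v in Set.Ioi (z / g), v ^ k * Real.exp (-v)) *
        (g * (1 - g) ^ k * a / (k.factorial : ℝ)) := by
  have h := integral_comp_mul_left_Ioi (fun v => v ^ k * Real.exp (-v)) z (inv_pos.2 hg)
  rw [inv_inv, smul_eq_mul, ← div_eq_inv_mul] at h
  have h' : ∀ I : ℝ, I * (g * (1 - g) ^ k * a / (k.factorial : ℝ)) =
      (g * I) * ((1 - g) ^ k * a / (k.factorial : ℝ)) := fun I => by ring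
  rw [h', ← h, ← integral_mul_const]
  congr with u
  have : g⁻¹ - 1 = g⁻¹ * (1 - g) := by field_simp
  rw [this, mul_pow, mul_pow, mul_comm u]
  ring

/-- The exponents combine as `u y / g + u (1 - y) = y u (1 / g - 1) + u`, and the powers of `u`
leave the inner integral. -/
theorem setIntegral_weakening_eq {g : ℝ} (hg : 0 < g) (z : ℝ) (k l : ℕ) {a : ℕ → ℝ} :
    ∫ u in Set.Ioi z, (g⁻¹ - 1) ^ k * (∏ h ∈ Finset.range (l + 1), (1 - a h)) *
      (u * ∫ y in Set.Ioo (0 : ℝ) 1, ((u * y) ^ k / k.factorial * Real.exp (-(u * y * g⁻¹))) *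
        ((u * (1 - y)) ^ l / l.factorial * Real.exp (-(u * (1 - y) * 1)))) * a (l + 1) =
    (∫ u in Set.Ioi z,
      (∫ y in (0 : ℝ)..1,
        y ^ k * (1 - y) ^ (l + 1 - 1) * Real.exp (-(y * u * (g⁻¹ - 1)))) *
      Real.exp (-u) * u ^ (k + (l + 1))) *
    (((1 - g) / g) ^ k * (∏ h ∈ Finset.range (l + 1), (1 - a h)) * a (l + 1) /
      ((k.factorial : ℝ) * ((l + 1 - 1).factorial : ℝ))) := by
  rw [← integral_mul_const]
  congr with u
  have h1 : (1 - g) / g = g⁻¹ - 1 := by field_simp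
  have h2 : ∀ y : ℝ, ((u * y) ^ k / k.factorial * Real.exp (-(u * y * g⁻¹))) *
      ((u * (1 - y)) ^ l / l.factorial * Real.exp (-(u * (1 - y) * 1))) =
      (y ^ k * (1 - y) ^ l * Real.exp (-(y * u * (g⁻¹ - 1)))) *
        (Real.exp (-u) * u ^ (k + l) / (k.factorial * l.factorial)) := by
    intro y
    have : Real.exp (-(u * y * g⁻¹)) * Real.exp (-(u * (1 - y) * 1)) =
        Real.exp (-(y * u * (g⁻¹ - 1))) * Real.exp (-u) := by
      rw [← Real.exp_add, ← Real.exp_add]; congr 1; ring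
    rw [mul_pow, mul_pow, pow_add]
    linear_combination (u ^ k * y ^ k * u ^ l * (1 - y) ^ l / (k.factorial * l.factorial)) * this
  simp only [h2, Nat.add_sub_cancel]
  rw [integral_mul_const, intervalIntegral.integral_of_le zero_le_one,
    integral_Ioc_eq_integral_Ioo, h1]
  ring

theorem theorem2 {Ω : Type*} [MeasurableSpace Ω] (P : Measure Ω) [IsProbabilityMeasure P]
    (F : Measure ℝ) [IsProbabilityMeasure F]
    -- the shocks `X 1, X 2, …` are i.i.d. with distribution `F`
    (X : ℕ → Ω → ℝ)
    (hX_meas : ∀ i, 1 ≤ i → Measurable (X i))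
    (hX_law : ∀ i, 1 ≤ i → Measure.map (X i) P = F)
    (hX_indep : iIndepFun (fun i : ℕ => X (i + 1)) P)
    (S : ℝ → LoadLevels)
    (hβ : Tendsto (fun t => tail F (S t).beta) atTop (𝓝 0))
    (g : ℝ) (hg01 : g ∈ Set.Icc (0 : ℝ) 1)
    (hg : Tendsto (fun t => tail F (S t).beta / tail F (S t).gamma) atTop (𝓝 g))
    (a : ℕ → ℕ → ℝ) (ha01 : ∀ k l, a k l ∈ Set.Ioc (0 : ℝ) 1)
    (ha : ∀ k l, Tendsto (fun t => tail F ((S t).level k l) / tail F (S t).beta)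
      atTop (𝓝 (a k l)))
    (z : ℝ) (hz : 0 ≤ z) :
    (0 < g →
      (∀ k : ℕ, Tendsto
        (fun t => P.real ((S t).failureEvent X (z / tail F (S t).beta) k 0)) atTop
        (𝓝 ((∫ v in Set.Ioi (z / g), v ^ k * Real.exp (-v)) *
          (g * (1 - g) ^ k * a k 0 / (k.factorial : ℝ))))) ∧
      (∀ k l : ℕ, 1 ≤ l → Tendsto
        (fun t => P.real ((S t).failureEvent X (z / tail F (S t).beta) k l)) atTop
        (𝓝 ((∫ u in Set.Ioi z,
            (∫ y in (0 : ℝ)..1,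
              y ^ k * (1 - y) ^ (l - 1) * Real.exp (-(y * u * (g⁻¹ - 1)))) *
            Real.exp (-u) * u ^ (k + l)) *
          (((1 - g) / g) ^ k * (∏ h ∈ Finset.range l, (1 - a k h)) * a k l /
            ((k.factorial : ℝ) * ((l - 1).factorial : ℝ))))))) ∧
    -- for `g = 0` the limits are the limiting values `0` of the two formulas
    (g = 0 → ∀ k l : ℕ, Tendsto
      (fun t => P.real ((S t).failureEvent X (z / tail F (S t).beta) k l)) atTop (𝓝 0)) := by
  classical
  have hX : IsShockSequence P F X := ⟨hX_meas, hX_law, hX_indep⟩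
  have hqnn : ∀ t, 0 ≤ tail F (S t).beta := fun t => tail_nonneg F _
  -- Division by zero gives `0`, so the positive limit `a 0 0` of the ratio excludes a vanishing
  -- tail at `beta`.
  have hq0 : ∀ᶠ t in atTop, 0 < tail F (S t).beta := by
    filter_upwards [(ha 0 0).eventually_const_lt (ha01 0 0).1] with t ht
    refine (hqnn t).lt_of_ne fun h => ?_
    rw [← h, div_zero] at ht
    exact lt_irrefl _ ht
  have hqp : ∀ t, tail F (S t).beta ≤ tail F (S t).gamma := fun t =>
    tail_anti F (S t).gamma_le_beta
  refine ⟨fun hg0 => ?_, fun hg0 k l => ?_⟩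
  · have hpq : Tendsto (fun t => tail F (S t).gamma / tail F (S t).beta) atTop (𝓝 g⁻¹) := by
      simpa only [inv_div] using hg.inv₀ hg0.ne'
    refine ⟨fun k => ?_, fun k l hl => ?_⟩
    · rw [← setIntegral_strengthening_eq hg0 (z := z) k (a k 0)]
      exact hX.tendsto_failureEvent_zero S hβ hq0 hpq k (ha k 0) hz
    · obtain ⟨l, rfl⟩ : ∃ m, l = m + 1 := ⟨l - 1, by omega⟩
      rw [← setIntegral_weakening_eq hg0 z k l]
      exact hX.tendsto_failureEvent_succ S hβ hq0 hpq k l (fun h => ha k h) hz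
  · rw [hg0] at hg
    refine tendsto_of_tendsto_of_tendsto_of_le_of_le' tendsto_const_nhds hg
      (Eventually.of_forall fun _ => measureReal_nonneg) ?_
    filter_upwards [hq0] with t ht using hX.measureReal_failureEvent_le (S t) ht _ k l
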